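/- Let $v>0$ and $R>0$. Let $q_1$ be a continuous real kernel on $[0,1]^2$ that is nonnegative, i.e. $\int_0^1\!\int_0^1 f(z)q_1(z,y)f(y)\,dy\,dz\ge 0$ for all continuous real $f$. Let $P_{ss}$ be the steady-state Riccati kernel of the optimal feedback, i.e. a continuous nonnegative kernel (in the same sense) on $[0,1]^2$ with $$v\,\partial_zP_{ss}+v\,\partial_yP_{ss}+q_1(z,y)-\tfrac1R P_{ss}(z,0)P_{ss}(0,y)=0,\qquad P_{ss}(z,1)=0,\quad P_{ss}(1,y)=0,$$ where $v\partial_z+v\partial_y$ is the derivative in the direction $(v,v)$. Let $S\in\mathbb C^{n\times n}$ and $q_r\in\mathbb C^n$, and let the demand signal be $q_r^Tw(t)$, where $\dot w=Sw$ for $t\ge 0$, $w(0)\in\mathbb C^n$ arbitrary. The regulator equations $v\,(m^T)'(z)+m^T(z)S=0$ on $[0,1]$, $m^T(1)=\frac1v q_r^T$, have exactly one solution $m^T$. Put $$m_w^T=\frac1{vR}\int_0^1P_{ss}(0,y)\,m^T(y)\,dy+m^T(0).$$ Consider the linearized production line $\partial_t\rho+v\,\partial_z\rho=0$ on $z\in[0,1]$,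 $t\ge0$, with initial profile $\rho(\cdot,0)=\rho_0$, influx $v\rho(0,t)=u(t)$ and outflux $y(t)=v\rho(1,t)$, under the control $$u(t)=-\frac1R\int_0^1P_{ss}(0,y)\rho(y,t)\,dy+v\,m_w^Tw(t).$$ Solutions are meant along characteristics ($\partial_t+v\partial_z$ is the derivative in the direction $(v,1)$), with $\rho(\cdot,t)$ integrable on $[0,1]$ for each $t\ge0$. Then for every solution $\rho$ of this closed loop the error state $e(z,t)=\rho(z,t)-m^T(z)w(t)$ satisfies $$\partial_te+v\,\partial_ze=0,\qquad v\,e(0,t)=-\frac1R\int_0^1P_{ss}(0,y)e(y,t)\,dy,\qquad e(z,0)=\rho_0(z)-m^T(z)w(0)\quad(0<z\le1),$$ the tracking error is $y(t)-q_r^Tw(t)=v\,e(1,t)$ for $t\ge0$, and $y(t)-q_r^Tw(t)\to0$ as $t\to+\infty$. -/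

import Mathlib

open Set Filter Topology MeasureTheory
open scoped Matrix

noncomputable section

/-- The integral operator on the unit interval with kernel `K` is nonnegative:
`⟨f, K f⟩ = ∫₀¹ f(z) (∫₀¹ K(z,y) f(y) dy) dz ≥ 0` for all continuous real `f`
(for a continuous kernel this is the same as for all `f` in `L²(0,1)`). -/
def KernelNonneg (K : ℝ → ℝ → ℝ) : Prop :=
  ∀ f : ℝ → ℝ, ContinuousOn f (Icc 0 1) →
    0 ≤ ∫ z in (0 : ℝ)..1, f z * ∫ y in (0 : ℝ)..1, K z y * f y

/-- `P` is the kernel of the steady-state optimal feedback for the state weight `q₁` and the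
input weight `R`: a continuous, nonnegative solution on the unit square of the stationary Riccati
equation `v ∂_z P + v ∂_y P + q₁(z,y) - R⁻¹ P(z,0) P(0,y) = 0` with `P(z,1) = 0 = P(1,y)`.
The operator `v ∂_z + v ∂_y` is the derivative in the direction `(v, v)`, taken within the square;
`P` need not be differentiable in `z` and `y` separately (it usually has a kink at `z = y`). -/
structure IsSteadyStateKernel (v R : ℝ) (q₁ P : ℝ → ℝ → ℝ) : Prop where
  continuousOn : ContinuousOn (Function.uncurry P) (Icc 0 1 ×ˢ Icc 0 1)
  riccati : ∀ z ∈ Icc (0 : ℝ) 1, ∀ y ∈ Icc (0 : ℝ) 1,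
    HasLineDerivWithinAt ℝ (Function.uncurry P) (R⁻¹ * P z 0 * P 0 y - q₁ z y)
      (Icc 0 1 ×ˢ Icc 0 1) (z, y) (v, v)
  right_zero : ∀ z ∈ Icc (0 : ℝ) 1, P z 1 = 0
  left_zero : ∀ y ∈ Icc (0 : ℝ) 1, P 1 y = 0
  nonneg : KernelNonneg P

/-- The linearized production line on `z ∈ [0,1]`, `t ≥ 0`: the density `ρ z t` solves
`∂_t ρ + v ∂_z ρ = 0` with influx `v ρ(0,t) = u(t)` and initial profile `ρ(z,0) = ρ₀(z)`.
The operator `∂_t + v ∂_z` is the derivative in the direction `(v, 1)`, taken within the domain.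
So every continuously differentiable solution is included, but `ρ₀` may be rough and need
not be compatible with the influx at the corner `(0,0)`, where the influx prescribes the value. -/
structure IsProductionLine (v : ℝ) (ρ₀ u : ℝ → ℂ) (ρ : ℝ → ℝ → ℂ) : Prop where
  integrable : ∀ t : ℝ, 0 ≤ t → IntervalIntegrable (fun z => ρ z t) volume 0 1
  transport : ∀ z ∈ Icc (0 : ℝ) 1, ∀ t : ℝ, 0 ≤ t →
    HasLineDerivWithinAt ℝ (Function.uncurry ρ) 0 (Icc 0 1 ×ˢ Ici 0) (z, t) (v, 1)
  influx : ∀ t : ℝ, 0 ≤ t → (v : ℂ) * ρ 0 t = u t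
  initial : ∀ z ∈ Ioc (0 : ℝ) 1, ρ z 0 = ρ₀ z

/-- The outflux `v ρ(1,t)`. -/
def outflux (v : ℝ) (ρ : ℝ → ℝ → ℂ) (t : ℝ) : ℂ := (v : ℂ) * ρ 1 t

/-- The optimal steady-state feedback `-R⁻¹ ∫₀¹ P(0,y) ρ(y,t) dy`. -/
def optimalFeedback (R : ℝ) (P : ℝ → ℝ → ℝ) (ρ : ℝ → ℝ → ℂ) (t : ℝ) : ℂ :=
  -((R : ℂ)⁻¹ * ∫ y in (0 : ℝ)..1, (P 0 y : ℂ) * ρ y t)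

/-- The exosystem `ẇ = S w` for `t ≥ 0`. -/
def IsExosystem {n : ℕ} (S : Matrix (Fin n) (Fin n) ℂ) (w : ℝ → Fin n → ℂ) : Prop :=
  ∀ t : ℝ, 0 ≤ t → HasDerivWithinAt w (S *ᵥ w t) (Ici 0) t

/-- The regulator equations `v mᵀ' + mᵀ S = 0` on `[0,1]`, `mᵀ(1) = v⁻¹ q_rᵀ`. -/
structure IsRegulatorSolution {n : ℕ} (v : ℝ) (S : Matrix (Fin n) (Fin n) ℂ) (qr : Fin n → ℂ)
    (m : ℝ → Fin n → ℂ) : Prop where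
  differentiable : DifferentiableOn ℝ m (Icc 0 1)
  ode : ∀ z ∈ Icc (0 : ℝ) 1, (v : ℂ) • derivWithin m (Icc 0 1) z + m z ᵥ* S = 0
  terminal : m 1 = (v : ℂ)⁻¹ • qr

/-- The feedforward gain `m_wᵀ = (v R)⁻¹ ∫₀¹ P(0,y) mᵀ(y) dy + mᵀ(0)`. -/
def feedforwardGain {n : ℕ} (v R : ℝ) (P : ℝ → ℝ → ℝ) (m : ℝ → Fin n → ℂ) : Fin n → ℂ :=
  ((v : ℂ) * R)⁻¹ • (∫ y in (0 : ℝ)..1, (P 0 y : ℂ) • m y) + m 0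

/-- The tracking controller: optimal feedback plus feedforward `v m_wᵀ w(t)`. -/
def trackingControl {n : ℕ} (v R : ℝ) (P : ℝ → ℝ → ℝ) (mw : Fin n → ℂ) (w : ℝ → Fin n → ℂ)
    (ρ : ℝ → ℝ → ℂ) (t : ℝ) : ℂ :=
  optimalFeedback R P ρ t + (v : ℂ) * (mw ⬝ᵥ w t)

/-- The error state `e(z,t) = ρ(z,t) - mᵀ(z) w(t)`. -/
def errorState {n : ℕ} (m w : ℝ → Fin n → ℂ) (ρ : ℝ → ℝ → ℂ) (z t : ℝ) : ℂ :=
  ρ z t - m z ⬝ᵥ w t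

end

/-!
The response `m(z) w(t)` is itself transported, because `m` solves the regulator equations, and it
has outflux `q_r w(t)`. Subtracting it from `ρ` therefore leaves a production line whose outflux is
the tracking error, and the feedforward gain is chosen so that this error line is closed by the
optimal feedback alone (`IsProductionLine.errorState`). What remains is stability of the closed
loop under the optimal feedback.

Along characteristics the error is `e(z,t) = g(v t - z)`, where `g` is the history of the inflow.
With `r = (R v)⁻¹`, the closed loop is the delay equation `g(s) = -r ∫₀¹ P(0,y) g(s - y) dy`
for `s ≥ 0`. Its kernel is real, so real and imaginary parts may be treated separately; and it is a
convolution with a continuous function, so `g` is continuous on `[0,∞)` although the initial profile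
is only integrable.

The Riccati kernel is a Lyapunov function. Let `V(T)` be the quadratic form of `P` on the
profile `z ↦ g(T - z)`. `P` is differentiable only along diagonals, so `V` is not differentiated;
rather, the identity `P(T-σ, T-η) = P(m-σ, m-η) + ∫ₘᵀ (∂_z P + ∂_y P)(τ-σ, τ-η) dτ` with
`m = max σ η` is integrated against `g(σ) g(η)` over `[0,T]²` (`energy_identity`). By the Riccati
equation and the feedback law `g = -r b`, `b(τ) = ∫₀¹ P(0,y) g(τ - y) dy`, the integrand for
`τ ≥ 1` is `-r b(τ)²` minus the nonnegative form of `q₁ / v`; here `P` need not be symmetric. As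
`V(T) ≥ 0`, the integral of `g²` over `[1,T]` is bounded in `T` (`exists_bound_integral_sq`).
Finally `g(t)²` is at most a constant times the integral of `g²` over `[t-1,t]`, which tends to
zero.
-/

/-! ### The energy identity for kernels with a diagonal derivative -/

/-- The kernel `d`, set to zero off the open unit square. -/
noncomputable def squareCutoff (d : ℝ → ℝ → ℝ) (z y : ℝ) : ℝ :=
  (Ioo (0 : ℝ) 1 ×ˢ Ioo (0 : ℝ) 1).indicator (Function.uncurry d) (z, y)

lemma squareCutoff_of_mem (d : ℝ → ℝ → ℝ) {z y : ℝ} (hz : z ∈ Ioo (0 : ℝ) 1)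
    (hy : y ∈ Ioo (0 : ℝ) 1) : squareCutoff d z y = d z y :=
  indicator_of_mem (show (z, y) ∈ Ioo (0 : ℝ) 1 ×ˢ Ioo (0 : ℝ) 1 from ⟨hz, hy⟩) _

lemma squareCutoff_of_not_mem (d : ℝ → ℝ → ℝ) {z y : ℝ}
    (h : ¬ (z ∈ Ioo (0 : ℝ) 1 ∧ y ∈ Ioo (0 : ℝ) 1)) : squareCutoff d z y = 0 :=
  indicator_of_notMem (fun h' => h ⟨h'.1, h'.2⟩) _

lemma measurable_squareCutoff {d : ℝ → ℝ → ℝ} (hd : Continuous (Function.uncurry d)) :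
    Measurable (Function.uncurry (squareCutoff d)) :=
  hd.measurable.indicator (measurableSet_Ioo.prod measurableSet_Ioo)

lemma exists_bound_squareCutoff {d : ℝ → ℝ → ℝ} (hd : Continuous (Function.uncurry d)) :
    ∃ C, ∀ z y, |squareCutoff d z y| ≤ C := by
  obtain ⟨C, hC⟩ := (isCompact_Icc (a := ((0 : ℝ), (0 : ℝ))) (b := (1, 1))).exists_bound_of_continuousOn
    hd.continuousOn
  refine ⟨max C 0, fun z y => ?_⟩
  by_cases h : z ∈ Ioo (0 : ℝ) 1 ∧ y ∈ Ioo (0 : ℝ) 1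
  · rw [squareCutoff_of_mem d h.1 h.2]
    exact (hC (z, y) ⟨⟨h.1.1.le, h.2.1.le⟩, ⟨h.1.2.le, h.2.2.le⟩⟩).trans (le_max_left _ _)
  · rw [squareCutoff_of_not_mem d h]
    simp

lemma integral_eq_of_zero_beyond {f : ℝ → ℝ} {a T : ℝ} (ha : 0 ≤ a) (haT : a ≤ T)
    (hf : ∀ x ∈ Ioc a T, f x = 0) : ∫ x in (0 : ℝ)..T, f x = ∫ x in (0 : ℝ)..a, f x := by
  rw [intervalIntegral.integral_of_le ha, intervalIntegral.integral_of_le (ha.trans haT)]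
  refine setIntegral_eq_of_subset_of_forall_sdiff_eq_zero measurableSet_Ioc
    (Ioc_subset_Ioc_right haT) fun x hx => hf x ⟨?_, hx.1.2⟩
  by_contra! h
  exact hx.2 ⟨hx.1.1, h⟩

/-- Two points `σ`, `η` entering the unit interval at the times `σ` and `η` see the kernel `p`
along a diagonal. It starts, at the time `max σ η`, with a value on the edge of the square, and
then changes by the integral of its diagonal derivative `d`. -/
lemma kernel_along_diagonal {p d : ℝ → ℝ → ℝ} (hp : Continuous (Function.uncurry p))
    (hd : Continuous (Function.uncurry d)) (hp0 : ∀ z y, 1 ≤ z ∨ 1 ≤ y → p z y = 0)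
    (hder : ∀ z ∈ Ioo (0 : ℝ) 1, ∀ y ∈ Ioo (0 : ℝ) 1,
      HasDerivAt (fun a => p (z + a) (y + a)) (d z y) 0)
    {σ η T : ℝ} (hσ : σ ≤ T) (hη : η ≤ T) (h0 : 0 ≤ max σ η) :
    p (T - σ) (T - η) = p (max σ η - σ) (max σ η - η)
      + ∫ τ in (0 : ℝ)..T, squareCutoff d (τ - σ) (τ - η) := by
  set m := max σ η with hm
  have hσm : σ ≤ m := le_max_left _ _
  have hηm : η ≤ m := le_max_right _ _
  have hmT : m ≤ T := max_le hσ hη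
  have hint : ∀ a b, IntervalIntegrable (fun τ => squareCutoff d (τ - σ) (τ - η)) volume a b := by
    intro a b
    obtain ⟨C, hC⟩ := exists_bound_squareCutoff hd
    refine (intervalIntegrable_const (c := C)).mono_fun' ?_ (ae_of_all _ fun τ => ?_)
    · exact ((measurable_squareCutoff hd).comp
        ((measurable_id.sub_const σ).prodMk (measurable_id.sub_const η))).aestronglyMeasurable
    · exact hC _ _
  have h1 : ∫ τ in (0 : ℝ)..m, squareCutoff d (τ - σ) (τ - η) = 0 := by
    rw [intervalIntegral.integral_congr (g := fun _ => 0), intervalIntegral.integral_zero]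
    intro τ hτ
    rw [uIcc_of_le h0] at hτ
    refine squareCutoff_of_not_mem d fun h => ?_
    rcases le_total σ η with h' | h'
    · have := h.2.1; rw [max_eq_right h'] at hm; linarith [hτ.2]
    · have := h.1.1; rw [max_eq_left h'] at hm; linarith [hτ.2]
  have h2 : ∫ τ in m..T, squareCutoff d (τ - σ) (τ - η)
      = p (T - σ) (T - η) - p (m - σ) (m - η) := by
    refine integral_eq_of_hasDerivAt_off_countable_of_le (fun τ => p (τ - σ) (τ - η)) _ hmT
      (s := {σ + 1, η + 1}) (Set.toFinite _).countable ?_ ?_ (hint _ _)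
    · exact (hp.comp (by fun_prop : Continuous fun τ : ℝ => (τ - σ, τ - η))).continuousOn
    · rintro τ ⟨⟨hτ, -⟩, hτs⟩
      have hτ1 : τ ≠ σ + 1 := fun h => hτs (by simp [h])
      have hτ2 : τ ≠ η + 1 := fun h => hτs (by simp [h])
      by_cases hmem : τ - σ ∈ Ioo (0 : ℝ) 1 ∧ τ - η ∈ Ioo (0 : ℝ) 1
      · rw [squareCutoff_of_mem d hmem.1 hmem.2]
        have := hder _ hmem.1 _ hmem.2
        have h3 : HasDerivAt (fun a => p (τ - σ + a) (τ - η + a)) (d (τ - σ) (τ - η)) (τ - τ) := by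
          simpa using this
        refine (h3.comp_sub_const τ τ).congr_of_eventuallyEq (Eventually.of_forall fun x => ?_)
        dsimp only
        congr 1 <;> ring
      · rw [squareCutoff_of_not_mem d hmem]
        have hbig : σ + 1 < τ ∨ η + 1 < τ := by
          by_contra! hcon
          have a1 := lt_of_le_of_ne hcon.1 hτ1
          have a2 := lt_of_le_of_ne hcon.2 hτ2
          exact hmem ⟨⟨by linarith, by linarith⟩, ⟨by linarith, by linarith⟩⟩
        refine (hasDerivAt_const τ (0 : ℝ)).congr_of_eventuallyEq ?_
        rcases hbig with h | h
        · filter_upwards [lt_mem_nhds h] with x hx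
          exact hp0 _ _ (Or.inl (by linarith))
        · filter_upwards [lt_mem_nhds h] with x hx
          exact hp0 _ _ (Or.inr (by linarith))
  rw [← intervalIntegral.integral_add_adjacent_intervals (hint 0 m) (hint m T), h1, h2]
  ring

/-- A double integral over the square `[0,T]²`, sliced by the larger coordinate. -/
lemma integral_square_eq_integral_max {g : ℝ → ℝ → ℝ} (hg : Continuous (Function.uncurry g))
    {T : ℝ} (hT : 0 ≤ T) :
    ∫ σ in (0 : ℝ)..T, ∫ η in (0 : ℝ)..T, g σ η
      = ∫ τ in (0 : ℝ)..T, ∫ η in (0 : ℝ)..τ, (g τ η + g η τ) := by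
  set μ := (volume : Measure ℝ).restrict (Ioc 0 T) with hμ
  have hgi : Integrable (Function.uncurry g) (μ.prod μ) := by
    rw [hμ, Measure.prod_restrict]
    exact (hg.continuousOn.integrableOn_compact (isCompact_Icc.prod isCompact_Icc)).mono_set
      (prod_mono Ioc_subset_Icc_self Ioc_subset_Icc_self)
  let A : Set (ℝ × ℝ) := {x | x.2 ≤ x.1}
  have hA : MeasurableSet A := measurableSet_le measurable_snd measurable_fst
  have i1 : Integrable (A.indicator (Function.uncurry g)) (μ.prod μ) := hgi.indicator hA
  have i2 : Integrable (Aᶜ.indicator (Function.uncurry g)) (μ.prod μ) := hgi.indicator hA.compl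
  have hc1 : ∀ s, Continuous fun η => g s η := fun s =>
    hg.comp (by fun_prop : Continuous fun η : ℝ => (s, η))
  have hc2 : ∀ s, Continuous fun η => g η s := fun s =>
    hg.comp (by fun_prop : Continuous fun η : ℝ => (η, s))
  have e1 : ∀ σ ∈ Ioc 0 T, ∫ η, A.indicator (Function.uncurry g) (σ, η) ∂μ
      = ∫ η in (0 : ℝ)..σ, g σ η := by
    intro σ hσ
    rw [intervalIntegral.integral_of_le hσ.1.le]
    have : (fun η => A.indicator (Function.uncurry g) (σ, η))
        = (Iic σ).indicator (fun η => g σ η) := by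
      ext η; by_cases h : η ≤ σ <;> simp [A, indicator, h]
    rw [this, hμ, setIntegral_indicator measurableSet_Iic, Ioc_inter_Iic, min_eq_right hσ.2]
  have e2 : ∀ η ∈ Ioc 0 T, ∫ σ, Aᶜ.indicator (Function.uncurry g) (σ, η) ∂μ
      = ∫ σ in (0 : ℝ)..η, g σ η := by
    intro η hη
    rw [intervalIntegral.integral_of_le hη.1.le]
    have : (fun σ => Aᶜ.indicator (Function.uncurry g) (σ, η))
        = (Iio η).indicator (fun σ => g σ η) := by
      ext σ; by_cases h : σ < η <;> simp [A, indicator, h]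
    rw [this, hμ, setIntegral_indicator measurableSet_Iio]
    have : Ioc 0 T ∩ Iio η = Ioo 0 η := by
      ext x; simp only [mem_inter_iff, mem_Ioc, mem_Iio, mem_Ioo]
      exact ⟨fun h => ⟨h.1.1, h.2⟩, fun h => ⟨⟨h.1, h.2.le.trans hη.2⟩, h.2⟩⟩
    rw [this, integral_Ioc_eq_integral_Ioo]
  have hL : ∫ σ in (0 : ℝ)..T, ∫ η in (0 : ℝ)..T, g σ η
      = ∫ x, Function.uncurry g x ∂(μ.prod μ) := by
    rw [integral_prod _ hgi, intervalIntegral.integral_of_le hT]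
    simp_rw [intervalIntegral.integral_of_le hT, Function.uncurry]
    rfl
  have hsplit : ∫ x, Function.uncurry g x ∂(μ.prod μ)
      = (∫ σ, ∫ η, A.indicator (Function.uncurry g) (σ, η) ∂μ ∂μ)
        + ∫ η, ∫ σ, Aᶜ.indicator (Function.uncurry g) (σ, η) ∂μ ∂μ := by
    rw [← integral_prod _ i1, ← integral_prod_symm _ i2, ← integral_add i1 i2]
    exact integral_congr_ae (ae_of_all _ fun x => (indicator_self_add_compl_apply A _ x).symm)
  rw [hL, hsplit, ← integral_add i1.integral_prod_left i2.integral_prod_right,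
    intervalIntegral.integral_of_le hT]
  refine setIntegral_congr_fun measurableSet_Ioc fun τ hτ => ?_
  rw [e1 τ hτ, e2 τ hτ, intervalIntegral.integral_add]
  · exact (hc1 τ).intervalIntegrable _ _
  · exact (hc2 τ).intervalIntegrable _ _

/-- The energy identity: for a transport line on `[0,1]` with inflow `H` (started empty), the
quadratic form of the kernel `p` at time `T` is the work of the inflow plus the contribution of
the diagonal derivative `d` of `p`. The total power is also integrable in time. -/
lemma energy_identity {p d : ℝ → ℝ → ℝ} (hp : Continuous (Function.uncurry p))
    (hd : Continuous (Function.uncurry d)) (hp0 : ∀ z y, 1 ≤ z ∨ 1 ≤ y → p z y = 0)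
    (hder : ∀ z ∈ Ioo (0 : ℝ) 1, ∀ y ∈ Ioo (0 : ℝ) 1,
      HasDerivAt (fun a => p (z + a) (y + a)) (d z y) 0)
    {H : ℝ → ℝ} (hH : Continuous H) {T : ℝ} (hT : 0 ≤ T) :
    IntervalIntegrable (fun τ =>
      (∫ η in (0 : ℝ)..τ, (p 0 (τ - η) + p (τ - η) 0) * (H τ * H η))
        + ∫ σ in (0 : ℝ)..τ, ∫ η in (0 : ℝ)..τ, squareCutoff d (τ - σ) (τ - η) * (H σ * H η))
      volume 0 T ∧
    ∫ σ in (0 : ℝ)..T, ∫ η in (0 : ℝ)..T, p (T - σ) (T - η) * (H σ * H η)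
      = ∫ τ in (0 : ℝ)..T,
          ((∫ η in (0 : ℝ)..τ, (p 0 (τ - η) + p (τ - η) 0) * (H τ * H η))
          + ∫ σ in (0 : ℝ)..τ, ∫ η in (0 : ℝ)..τ,
              squareCutoff d (τ - σ) (τ - η) * (H σ * H η)) := by
  set μ := (volume : Measure ℝ).restrict (Ioc 0 T) with hμ
  let Φ : (ℝ × ℝ) → ℝ → ℝ := fun x τ => squareCutoff d (τ - x.1) (τ - x.2) * (H x.1 * H x.2)
  have hHi : Integrable H μ :=
    (hH.continuousOn.integrableOn_compact isCompact_Icc).mono_set Ioc_subset_Icc_self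
  have hΦ : Integrable (Function.uncurry Φ) ((μ.prod μ).prod μ) := by
    obtain ⟨C, hC⟩ := exists_bound_squareCutoff hd
    have hHH : Integrable (fun x : (ℝ × ℝ) × ℝ => H x.1.1 * H x.1.2) ((μ.prod μ).prod μ) := by
      have := (hHi.mul_prod hHi).mul_prod (integrable_const (1 : ℝ) (μ := μ))
      simpa using this
    refine hHH.bdd_mul (c := C) ?_ (ae_of_all _ fun x => hC _ _)
    exact ((measurable_squareCutoff hd).comp
      (by fun_prop : Measurable fun x : (ℝ × ℝ) × ℝ => (x.2 - x.1.1, x.2 - x.1.2))).aestronglyMeasurable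
  let g : ℝ → ℝ → ℝ := fun σ η => p (max σ η - σ) (max σ η - η) * (H σ * H η)
  have hg : Continuous (Function.uncurry g) := by
    have : Continuous fun x : ℝ × ℝ => (max x.1 x.2 - x.1, max x.1 x.2 - x.2) := by fun_prop
    exact (hp.comp this).mul (by fun_prop)
  have hgi : Integrable (Function.uncurry g) (μ.prod μ) := by
    rw [hμ, Measure.prod_restrict]
    exact (hg.continuousOn.integrableOn_compact (isCompact_Icc.prod isCompact_Icc)).mono_set
      (prod_mono Ioc_subset_Icc_self Ioc_subset_Icc_self)
  have hV : Continuous fun x : ℝ × ℝ => p (T - x.1) (T - x.2) * (H x.1 * H x.2) :=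
    (hp.comp (by fun_prop : Continuous fun x : ℝ × ℝ => (T - x.1, T - x.2))).mul (by fun_prop)
  have hVi : Integrable (fun x : ℝ × ℝ => p (T - x.1) (T - x.2) * (H x.1 * H x.2)) (μ.prod μ) := by
    rw [hμ, Measure.prod_restrict]
    exact (hV.continuousOn.integrableOn_compact (isCompact_Icc.prod isCompact_Icc)).mono_set
      (prod_mono Ioc_subset_Icc_self Ioc_subset_Icc_self)
  have hdouble : ∀ {f : ℝ → ℝ → ℝ}, Integrable (Function.uncurry f) (μ.prod μ) →
      ∫ σ in (0 : ℝ)..T, ∫ η in (0 : ℝ)..T, f σ η = ∫ x, f x.1 x.2 ∂(μ.prod μ) := by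
    intro f hf
    rw [show (∫ x, f x.1 x.2 ∂(μ.prod μ)) = ∫ x, Function.uncurry f x ∂(μ.prod μ) from rfl,
      integral_prod _ hf, intervalIntegral.integral_of_le hT]
    simp_rw [intervalIntegral.integral_of_le hT, Function.uncurry]
    rfl
  have hmem : ∀ᵐ x ∂(μ.prod μ), x ∈ Ioc 0 T ×ˢ Ioc 0 T := by
    rw [hμ, Measure.prod_restrict]
    exact ae_restrict_mem (measurableSet_Ioc.prod measurableSet_Ioc)
  have key : ∫ x : ℝ × ℝ, p (T - x.1) (T - x.2) * (H x.1 * H x.2) ∂(μ.prod μ)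
      = (∫ x : ℝ × ℝ, g x.1 x.2 ∂(μ.prod μ)) + ∫ x : ℝ × ℝ, ∫ τ, Φ x τ ∂μ ∂(μ.prod μ) := by
    rw [← integral_add (f := fun x : ℝ × ℝ => g x.1 x.2)
      (g := fun x => ∫ τ, Φ x τ ∂μ) hgi hΦ.integral_prod_left]
    refine integral_congr_ae ?_
    filter_upwards [hmem] with x hx
    have := kernel_along_diagonal hp hd hp0 hder hx.1.2 hx.2.2 (hx.1.1.le.trans (le_max_left _ _))
    simp only [g, Φ]
    rw [this, integral_mul_const, intervalIntegral.integral_of_le hT]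
    ring
  have hswap : ∫ x : ℝ × ℝ, ∫ τ, Φ x τ ∂μ ∂(μ.prod μ)
      = ∫ τ, (∫ σ in (0 : ℝ)..T, ∫ η in (0 : ℝ)..T,
              squareCutoff d (τ - σ) (τ - η) * (H σ * H η)) ∂μ := by
    rw [integral_integral_swap hΦ]
    refine integral_congr_ae ?_
    filter_upwards [hΦ.prod_left_ae] with τ hτ
    exact (hdouble (f := fun σ η => squareCutoff d (τ - σ) (τ - η) * (H σ * H η)) hτ).symm
  have hswapi : Integrable (fun τ => ∫ σ in (0 : ℝ)..T, ∫ η in (0 : ℝ)..T,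
              squareCutoff d (τ - σ) (τ - η) * (H σ * H η)) μ := by
    refine hΦ.integral_prod_right.congr ?_
    filter_upwards [hΦ.prod_left_ae] with τ hτ
    exact (hdouble (f := fun σ η => squareCutoff d (τ - σ) (τ - η) * (H σ * H η)) hτ).symm
  have hcorner : Continuous fun τ : ℝ =>
      ∫ η in (0 : ℝ)..τ, (p 0 (τ - η) + p (τ - η) 0) * (H τ * H η) := by
    refine intervalIntegral.continuous_parametric_intervalIntegral_of_continuous
      (f := fun τ η => (p 0 (τ - η) + p (τ - η) 0) * (H τ * H η)) ?_ continuous_id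
    exact ((hp.comp (by fun_prop : Continuous fun x : ℝ × ℝ => ((0 : ℝ), x.1 - x.2))).add
      (hp.comp (by fun_prop : Continuous fun x : ℝ × ℝ => (x.1 - x.2, (0 : ℝ))))).mul (by fun_prop)
  have hI := (hcorner.intervalIntegrable (μ := volume) 0 T).add
    ((intervalIntegrable_iff_integrableOn_Ioc_of_le hT).2 hswapi)
  -- a point that enters after the time `τ` is not yet seen by the cutoff kernel
  have hpast : ∀ τ ∈ Icc 0 T, (∫ σ in (0 : ℝ)..T, ∫ η in (0 : ℝ)..T,
        squareCutoff d (τ - σ) (τ - η) * (H σ * H η))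
      = ∫ σ in (0 : ℝ)..τ, ∫ η in (0 : ℝ)..τ, squareCutoff d (τ - σ) (τ - η) * (H σ * H η) := by
    intro τ hτ
    rw [integral_eq_of_zero_beyond hτ.1 hτ.2]
    · refine intervalIntegral.integral_congr fun σ _ => integral_eq_of_zero_beyond hτ.1 hτ.2 ?_
      intro η hη
      rw [squareCutoff_of_not_mem d fun h => by linarith [h.2.1, hη.1], zero_mul]
    · intro σ hσ
      simp [squareCutoff_of_not_mem d fun h => not_lt.2 hσ.1.le (sub_pos.1 h.1.1)]
  refine ⟨hI.congr fun τ hτ => ?_, ?_⟩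
  · rw [uIoc_of_le hT] at hτ
    exact congrArg₂ _ rfl (hpast τ (Ioc_subset_Icc_self hτ))
  rw [hdouble (f := fun σ η => p (T - σ) (T - η) * (H σ * H η)) hVi, key, ← hdouble hgi,
    integral_square_eq_integral_max hg hT, hswap]
  have hg_eq : ∀ τ ∈ Icc 0 T, ∫ η in (0 : ℝ)..τ, (g τ η + g η τ)
      = ∫ η in (0 : ℝ)..τ, (p 0 (τ - η) + p (τ - η) 0) * (H τ * H η) := by
    intro τ hτ
    refine intervalIntegral.integral_congr fun η hη => ?_
    rw [uIcc_of_le hτ.1] at hη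
    simp only [g, max_eq_left hη.2, max_eq_right hη.2, sub_self]
    ring
  rw [intervalIntegral.integral_congr (g := fun τ =>
      ∫ η in (0 : ℝ)..τ, (p 0 (τ - η) + p (τ - η) 0) * (H τ * H η))
      (fun τ hτ => hg_eq τ (by rwa [uIcc_of_le hT] at hτ)),
    ← intervalIntegral.integral_of_le hT,
    ← intervalIntegral.integral_add (hcorner.intervalIntegrable _ _)
      ((intervalIntegrable_iff_integrableOn_Ioc_of_le hT).2 hswapi)]
  refine intervalIntegral.integral_congr fun τ hτ => ?_
  rw [uIcc_of_le hT] at hτ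
  exact congrArg₂ _ rfl (hpast τ hτ)

/-! ### Dissipation and decay for the delay equation -/

/-- Passing to the position variable `z = τ - σ`, the quadratic form of a kernel supported in
`[0,1)²` becomes that of the profile `z ↦ H (τ - z)` on the unit interval. -/
lemma integral_history_eq_profile {K : ℝ → ℝ → ℝ} (hK : ∀ z y, 1 ≤ z ∨ 1 ≤ y → K z y = 0)
    (H : ℝ → ℝ) {τ : ℝ} (hτ : 1 ≤ τ) :
    ∫ σ in (0 : ℝ)..τ, ∫ η in (0 : ℝ)..τ, K (τ - σ) (τ - η) * (H σ * H η)
      = ∫ z in (0 : ℝ)..1, H (τ - z) * ∫ y in (0 : ℝ)..1, K z y * H (τ - y) := by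
  have h1 := intervalIntegral.integral_comp_sub_left (a := 0) (b := τ)
    (fun z => ∫ η in (0 : ℝ)..τ, K z (τ - η) * (H (τ - z) * H η)) τ
  simp only [sub_sub_cancel, sub_self, sub_zero] at h1
  rw [h1, integral_eq_of_zero_beyond zero_le_one hτ]
  · refine intervalIntegral.integral_congr fun z _ => ?_
    have h2 := intervalIntegral.integral_comp_sub_left (a := 0) (b := τ)
      (fun y => K z y * (H (τ - z) * H (τ - y))) τ
    simp only [sub_sub_cancel, sub_self, sub_zero] at h2
    rw [h2, integral_eq_of_zero_beyond zero_le_one hτ, ← intervalIntegral.integral_const_mul]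
    · exact intervalIntegral.integral_congr fun y _ => by ring
    · intro y hy
      rw [hK z y (Or.inr hy.1.le), zero_mul]
  · intro z hz
    simp [hK z _ (Or.inl hz.1.le)]

lemma integral_history_eq_profile_single {k : ℝ → ℝ} (hk : ∀ y, 1 ≤ y → k y = 0)
    (H : ℝ → ℝ) {τ : ℝ} (hτ : 1 ≤ τ) :
    ∫ η in (0 : ℝ)..τ, k (τ - η) * H η = ∫ y in (0 : ℝ)..1, k y * H (τ - y) := by
  have h := intervalIntegral.integral_comp_sub_left (a := 0) (b := τ)
    (fun y => k y * H (τ - y)) τ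
  simp only [sub_sub_cancel, sub_self, sub_zero] at h
  rw [h, integral_eq_of_zero_beyond zero_le_one hτ]
  intro y hy
  rw [hk y hy.1.le, zero_mul]

lemma integral_congr_Ioo {f g : ℝ → ℝ} (h : ∀ x ∈ Ioo (0 : ℝ) 1, f x = g x) :
    ∫ x in (0 : ℝ)..1, f x = ∫ x in (0 : ℝ)..1, g x := by
  rw [intervalIntegral.integral_of_le zero_le_one, intervalIntegral.integral_of_le zero_le_one,
    integral_Ioc_eq_integral_Ioo, integral_Ioc_eq_integral_Ioo]
  exact setIntegral_congr_fun measurableSet_Ioo h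

lemma sq_integral_le_integral_sq {g : ℝ → ℝ} (hg : Continuous g) :
    (∫ x in (0 : ℝ)..1, g x) ^ 2 ≤ ∫ x in (0 : ℝ)..1, g x ^ 2 := by
  set c := ∫ x in (0 : ℝ)..1, g x with hc
  have h0 : 0 ≤ ∫ x in (0 : ℝ)..1, (g x - c) ^ 2 :=
    intervalIntegral.integral_nonneg zero_le_one fun x _ => sq_nonneg _
  have h1 : ∫ x in (0 : ℝ)..1, (g x - c) ^ 2
      = (∫ x in (0 : ℝ)..1, g x ^ 2) - 2 * c * (∫ x in (0 : ℝ)..1, g x) + c ^ 2 := by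
    rw [intervalIntegral.integral_congr (g := fun x => g x ^ 2 - 2 * c * g x + c ^ 2)
      (fun x _ => by ring), intervalIntegral.integral_add, intervalIntegral.integral_sub,
      intervalIntegral.integral_const_mul]
    · simp
    all_goals exact Continuous.intervalIntegrable (by fun_prop) _ _
  rw [h1, ← hc] at h0
  nlinarith

/-- The energy dissipation: the square of the inflow of a closed loop with nonnegative Riccati
kernel `p` has bounded integral. -/
lemma exists_bound_integral_sq {r : ℝ} (hr : 0 < r) {p q : ℝ → ℝ → ℝ}
    (hp : Continuous (Function.uncurry p)) (hq : Continuous (Function.uncurry q))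
    (hp0 : ∀ z y, 1 ≤ z ∨ 1 ≤ y → p z y = 0)
    (hder : ∀ z ∈ Ioo (0 : ℝ) 1, ∀ y ∈ Ioo (0 : ℝ) 1,
      HasDerivAt (fun a => p (z + a) (y + a)) (r * p z 0 * p 0 y - q z y) 0)
    (hpn : KernelNonneg p) (hqn : KernelNonneg q) {H : ℝ → ℝ} (hH : Continuous H)
    (heq : ∀ t, 1 ≤ t → H t = -(r * ∫ y in (0 : ℝ)..1, p 0 y * H (t - y))) :
    ∃ C, ∀ T, 1 ≤ T → ∫ t in (1 : ℝ)..T, H t ^ 2 ≤ C := by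
  set d : ℝ → ℝ → ℝ := fun z y => r * p z 0 * p 0 y - q z y with hd_def
  have hcz : Continuous fun z => p z 0 := hp.comp (by fun_prop : Continuous fun z : ℝ => (z, (0 : ℝ)))
  have hcy : Continuous fun y => p 0 y := hp.comp (by fun_prop : Continuous fun y : ℝ => ((0 : ℝ), y))
  have hd : Continuous (Function.uncurry d) :=
    ((continuous_const.mul (hcz.comp continuous_fst)).mul (hcy.comp continuous_snd)).sub hq
  set I : ℝ → ℝ := fun τ =>
      (∫ η in (0 : ℝ)..τ, (p 0 (τ - η) + p (τ - η) 0) * (H τ * H η))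
        + ∫ σ in (0 : ℝ)..τ, ∫ η in (0 : ℝ)..τ, squareCutoff d (τ - σ) (τ - η) * (H σ * H η)
    with hI_def
  -- the dissipation inequality, where the feedback law completes the square
  have hdiss : ∀ τ, 1 ≤ τ → I τ ≤ -(r⁻¹ * H τ ^ 2) := by
    intro τ hτ
    have hf : Continuous fun y => H (τ - y) := by fun_prop
    set b := ∫ y in (0 : ℝ)..1, p 0 y * H (τ - y) with hb
    set a := ∫ y in (0 : ℝ)..1, p y 0 * H (τ - y) with ha
    have h1 : ∫ η in (0 : ℝ)..τ, (p 0 (τ - η) + p (τ - η) 0) * (H τ * H η) = H τ * (b + a) := by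
      have := integral_history_eq_profile_single (k := fun y => H τ * (p 0 y + p y 0))
        (fun y hy => by rw [hp0 0 y (Or.inr hy), hp0 y 0 (Or.inl hy)]; ring) H hτ
      rw [intervalIntegral.integral_congr
        (g := fun η => H τ * (p 0 (τ - η) + p (τ - η) 0) * H η) (fun η _ => by ring), this, hb, ha,
        ← intervalIntegral.integral_add (f := fun y => p 0 y * H (τ - y))
          (g := fun y => p y 0 * H (τ - y)) ((hcy.mul hf).intervalIntegrable _ _)
          ((hcz.mul hf).intervalIntegrable _ _), ← intervalIntegral.integral_const_mul]
      exact intervalIntegral.integral_congr fun y _ => by ring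
    have h2 : ∫ σ in (0 : ℝ)..τ, ∫ η in (0 : ℝ)..τ, squareCutoff d (τ - σ) (τ - η) * (H σ * H η)
        = r * a * b
          - ∫ z in (0 : ℝ)..1, H (τ - z) * ∫ y in (0 : ℝ)..1, q z y * H (τ - y) := by
      rw [integral_history_eq_profile (K := squareCutoff d) ?_ H hτ]
      · have hqc : Continuous fun z => ∫ y in (0 : ℝ)..1, q z y * H (τ - y) :=
          intervalIntegral.continuous_parametric_intervalIntegral_of_continuous'
            (f := fun z y => q z y * H (τ - y)) (hq.mul (by fun_prop)) 0 1
        have hqz : ∀ z, Continuous fun y => q z y := fun z =>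
          hq.comp (by fun_prop : Continuous fun y : ℝ => (z, y))
        rw [integral_congr_Ioo (g := fun z => r * b * (p z 0 * H (τ - z))
          - H (τ - z) * ∫ y in (0 : ℝ)..1, q z y * H (τ - y)), intervalIntegral.integral_sub,
          intervalIntegral.integral_const_mul]
        · rw [← ha]; ring
        · exact (continuous_const.mul (hcz.mul hf)).intervalIntegrable _ _
        · exact (hf.mul hqc).intervalIntegrable _ _
        · intro z hz
          rw [integral_congr_Ioo (g := fun y => r * p z 0 * (p 0 y * H (τ - y))
            - q z y * H (τ - y)), intervalIntegral.integral_sub,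
            intervalIntegral.integral_const_mul]
          · ring
          · exact (continuous_const.mul (hcy.mul hf)).intervalIntegrable _ _
          · exact ((hqz z).mul hf).intervalIntegrable _ _
          · intro y hy
            rw [squareCutoff_of_mem d hz hy]
            ring
      · rintro z y (h | h)
        · exact squareCutoff_of_not_mem d fun h' => not_lt.2 h h'.1.2
        · exact squareCutoff_of_not_mem d fun h' => not_lt.2 h h'.2.2
    have h3 := hqn (fun z => H (τ - z)) hf.continuousOn
    have h4 : H τ = -(r * b) := heq τ hτ
    have h5 : r⁻¹ * H τ ^ 2 = r * b ^ 2 := by rw [h4]; field_simp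
    rw [hI_def]
    dsimp only
    rw [h1, h2, h5, h4]
    nlinarith
  refine ⟨r * ∫ τ in (0 : ℝ)..1, I τ, fun T hT => ?_⟩
  obtain ⟨hIi, hV⟩ := energy_identity hp hd hp0 hder hH (zero_le_one.trans hT)
  have hV0 : 0 ≤ ∫ τ in (0 : ℝ)..T, I τ := by
    rw [hI_def, ← hV, integral_history_eq_profile hp0 H hT]
    exact hpn _ (by fun_prop)
  have hi1 : IntervalIntegrable I volume 0 1 :=
    hIi.mono_set (by rw [uIcc_of_le zero_le_one, uIcc_of_le (zero_le_one.trans hT)]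
                     exact Icc_subset_Icc_right hT)
  have hi2 : IntervalIntegrable I volume 1 T :=
    hIi.mono_set (by rw [uIcc_of_le hT, uIcc_of_le (zero_le_one.trans hT)]
                     exact Icc_subset_Icc_left zero_le_one)
  rw [← intervalIntegral.integral_add_adjacent_intervals hi1 hi2] at hV0
  have hmono : ∫ τ in (1 : ℝ)..T, I τ ≤ ∫ τ in (1 : ℝ)..T, -(r⁻¹ * H τ ^ 2) :=
    intervalIntegral.integral_mono_on hT hi2
      (Continuous.intervalIntegrable (by fun_prop) _ _) fun τ hτ => hdiss τ hτ.1
  rw [intervalIntegral.integral_neg, intervalIntegral.integral_const_mul] at hmono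
  have : r⁻¹ * ∫ t in (1 : ℝ)..T, H t ^ 2 ≤ ∫ τ in (0 : ℝ)..1, I τ := by linarith
  rwa [inv_mul_le_iff₀ hr] at this

/-- A continuous function with square-integrable tail that is a bounded functional of its own
recent history tends to zero. -/
lemma tendsto_zero_of_bound_integral_sq {k : ℝ → ℝ} (hk : Continuous k) {r C : ℝ}
    {H : ℝ → ℝ} (hH : Continuous H)
    (heq : ∀ t, 1 ≤ t → H t = -(r * ∫ y in (0 : ℝ)..1, k y * H (t - y)))
    (hC : ∀ T, 1 ≤ T → ∫ t in (1 : ℝ)..T, H t ^ 2 ≤ C) : Tendsto H atTop (𝓝 0) := by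
  have hint : ∀ a b, IntervalIntegrable (fun t => H t ^ 2) volume a b := fun a b =>
    Continuous.intervalIntegrable (by fun_prop) _ _
  set F : ℝ → ℝ := fun t => ∫ s in (1 : ℝ)..t, H s ^ 2 with hF
  have hdiff : ∀ s t, F t - F s = ∫ x in s..t, H x ^ 2 := fun s t =>
    intervalIntegral.integral_interval_sub_left (hint _ _) (hint _ _)
  have hmono : Monotone F := fun s t hst => by
    rw [← sub_nonneg, hdiff]
    exact intervalIntegral.integral_nonneg hst fun x _ => sq_nonneg _
  have hbdd : BddAbove (range F) := by
    refine ⟨C, ?_⟩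
    rintro _ ⟨t, rfl⟩
    exact (hmono (le_max_right 1 t)).trans (hC _ (le_max_left _ _))
  have hlim := tendsto_atTop_ciSup hmono hbdd
  have hwin : Tendsto (fun t => ∫ x in (t - 1)..t, H x ^ 2) atTop (𝓝 0) := by
    have h1 : Tendsto (fun t : ℝ => t - 1) atTop atTop := tendsto_atTop_add_const_right _ _ tendsto_id
    have := hlim.sub (hlim.comp h1)
    rw [sub_self] at this
    exact this.congr fun t => hdiff _ _
  obtain ⟨M, hM⟩ := (isCompact_Icc (a := (0 : ℝ)) (b := 1)).exists_bound_of_continuousOn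
    hk.continuousOn
  have hsq : Tendsto (fun t => H t ^ 2) atTop (𝓝 0) := by
    have hup : Tendsto (fun t => r ^ 2 * M ^ 2 * ∫ x in (t - 1)..t, H x ^ 2) atTop (𝓝 0) := by
      simpa using hwin.const_mul (r ^ 2 * M ^ 2)
    refine tendsto_of_tendsto_of_tendsto_of_le_of_le' tendsto_const_nhds hup
      (Eventually.of_forall fun t => sq_nonneg _) ?_
    filter_upwards [eventually_ge_atTop 1] with t ht
    have hf : Continuous fun y => H (t - y) := by fun_prop
    have h1 := sq_integral_le_integral_sq (hk.mul hf)
    have h2 : ∫ y in (0 : ℝ)..1, (k y * H (t - y)) ^ 2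
        ≤ ∫ y in (0 : ℝ)..1, M ^ 2 * H (t - y) ^ 2 := by
      refine intervalIntegral.integral_mono_on zero_le_one
        (Continuous.intervalIntegrable (by fun_prop) _ _)
        (Continuous.intervalIntegrable (by fun_prop) _ _) fun y hy => ?_
      rw [mul_pow]
      exact mul_le_mul_of_nonneg_right (sq_le_sq' (abs_le.1 (hM y hy)).1 (abs_le.1 (hM y hy)).2)
        (sq_nonneg _)
    have h3 := intervalIntegral.integral_comp_sub_left (a := 0) (b := 1) (fun x => H x ^ 2) t
    rw [sub_zero] at h3
    rw [intervalIntegral.integral_const_mul, h3] at h2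
    have h4 := h1.trans h2
    rw [heq t ht, neg_sq, mul_pow, mul_assoc]
    exact mul_le_mul_of_nonneg_left h4 (sq_nonneg r)
  have := hsq.sqrt
  simp only [Real.sqrt_sq_eq_abs, Real.sqrt_zero] at this
  exact (tendsto_zero_iff_abs_tendsto_zero _).2 this

/-- A locally integrable solution of the delay equation is continuous for nonnegative times: the
delay operator is a convolution with a continuous kernel. -/
lemma continuousOn_of_delay_equation {k : ℝ → ℝ} (hk : Continuous k) (hk1 : ∀ y, 1 ≤ y → k y = 0)
    {r : ℝ} {h : ℝ → ℝ} (hint : ∀ N, 0 ≤ N → IntervalIntegrable h volume (-1) N)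
    (heq : ∀ s, 0 ≤ s → h s = -(r * ∫ y in (0 : ℝ)..1, k y * h (s - y))) :
    ContinuousOn h (Ici 0) := by
  -- freezing `k` on the negative axis turns the truncated convolution into a full one, up to a
  -- primitive of `h`
  set κ : ℝ → ℝ := fun y => k (max 0 y) with hκ
  have hκc : Continuous κ := by fun_prop
  obtain ⟨M, hM⟩ := (isCompact_Icc (a := (0 : ℝ)) (b := 1)).exists_bound_of_continuousOn
    hk.continuousOn
  have hκM : ∀ y, ‖κ y‖ ≤ max M 0 := by
    intro y
    rcases le_or_gt 1 y with h1 | h1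
    · rw [hκ]
      dsimp only
      rw [hk1 _ (h1.trans (le_max_right _ _)), norm_zero]
      exact le_max_right _ _
    · exact (hM _ ⟨le_max_left _ _, max_le zero_le_one h1.le⟩).trans (le_max_left _ _)
  have hκi : ∀ s {a b : ℝ}, IntervalIntegrable h volume a b →
      IntervalIntegrable (fun x => κ (s - x) * h x) volume a b := fun s a b hab =>
    hab.continuousOn_mul (by fun_prop)
  intro s₀ hs₀
  set N := s₀ + 1 with hN
  have hN0 : 0 ≤ N := by have : (0 : ℝ) ≤ s₀ := hs₀; linarith
  have hNi := hint N hN0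
  have hconv : ∀ s ∈ Icc 0 N, ∫ y in (0 : ℝ)..1, k y * h (s - y)
      = (∫ x in (-1 : ℝ)..N, κ (s - x) * h x) - k 0 * ∫ x in s..N, h x := by
    intro s hs
    have i1 : IntervalIntegrable h volume (-1) (s - 1) := hNi.mono_set (by
      rw [uIcc_of_le (by linarith [hs.1]), uIcc_of_le (by linarith)]
      exact Icc_subset_Icc_right (by linarith [hs.2]))
    have i2 : IntervalIntegrable h volume (s - 1) s := hNi.mono_set (by
      rw [uIcc_of_le (by linarith), uIcc_of_le (by linarith)]
      exact Icc_subset_Icc (by linarith [hs.1]) hs.2)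
    have i3 : IntervalIntegrable h volume s N := hNi.mono_set (by
      rw [uIcc_of_le hs.2, uIcc_of_le (by linarith)]
      exact Icc_subset_Icc_left (by linarith [hs.1]))
    have e1 : ∫ x in (-1 : ℝ)..(s - 1), κ (s - x) * h x = 0 := by
      rw [intervalIntegral.integral_congr (g := fun _ => 0), intervalIntegral.integral_zero]
      intro x hx
      rw [uIcc_of_le (by linarith [hs.1])] at hx
      simp [hκ, hk1 (max 0 (s - x)) (le_max_of_le_right (by linarith [hx.2]))]
    have e2 : ∫ x in (s - 1)..s, κ (s - x) * h x = ∫ y in (0 : ℝ)..1, k y * h (s - y) := by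
      have := intervalIntegral.integral_comp_sub_left (a := 0) (b := 1)
        (fun x => κ (s - x) * h x) s
      rw [sub_zero] at this
      rw [← this]
      refine intervalIntegral.integral_congr fun y hy => ?_
      rw [uIcc_of_le zero_le_one] at hy
      simp [hκ, max_eq_right hy.1]
    have e3 : ∫ x in s..N, κ (s - x) * h x = k 0 * ∫ x in s..N, h x := by
      rw [← intervalIntegral.integral_const_mul]
      refine intervalIntegral.integral_congr fun x hx => ?_
      rw [uIcc_of_le hs.2] at hx
      simp [hκ, max_eq_left (sub_nonpos.2 hx.1)]
    rw [← intervalIntegral.integral_add_adjacent_intervals (hκi s (i1.trans i2)) (hκi s i3),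
      ← intervalIntegral.integral_add_adjacent_intervals (hκi s i1) (hκi s i2), e1, e2, e3]
    ring
  have c1 : Continuous fun s => ∫ x in (-1 : ℝ)..N, κ (s - x) * h x := by
    refine intervalIntegral.continuous_of_dominated_interval (bound := fun x => max M 0 * ‖h x‖)
      (fun s => (hκi s hNi).def'.aestronglyMeasurable)
      (fun s => ae_of_all _ fun x _ => ?_) (hNi.norm.const_mul _)
      (ae_of_all _ fun x _ => by fun_prop)
    rw [norm_mul]
    exact mul_le_mul_of_nonneg_right (hκM _) (norm_nonneg _)
  have c2 : ContinuousOn (fun s => ∫ x in s..N, h x) (Icc 0 N) := by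
    have := intervalIntegral.continuousOn_primitive_interval_left (a := 0) (b := N) (f := h)
      (μ := volume) ?_
    · rwa [uIcc_of_le hN0] at this
    · rw [uIcc_of_le hN0, ← intervalIntegrable_iff_integrableOn_Icc_of_le hN0]
      refine hNi.mono_set ?_
      rw [uIcc_of_le hN0, uIcc_of_le (by linarith)]
      exact Icc_subset_Icc_left (by norm_num)
  have c3 : ContinuousOn h (Icc 0 N) := by
    refine ContinuousOn.congr (f := fun s =>
      -(r * ((∫ x in (-1 : ℝ)..N, κ (s - x) * h x) - k 0 * ∫ x in s..N, h x))) ?_ ?_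
    · exact (continuousOn_const.mul (c1.continuousOn.sub (continuousOn_const.mul c2))).neg
    · intro s hs
      rw [heq s hs.1, hconv s hs]
  refine (c3 s₀ ⟨hs₀, by linarith⟩).mono_of_mem_nhdsWithin ?_
  have : Iio N ∈ 𝓝 s₀ := Iio_mem_nhds (by linarith)
  filter_upwards [mem_nhdsWithin_of_mem_nhds this, self_mem_nhdsWithin] with x hx hx0
  exact ⟨hx0, le_of_lt hx⟩

/-- Stability of the scalar closed loop, written as a delay equation for the inflow. -/
lemma tendsto_zero_of_delay_equation {r : ℝ} (hr : 0 < r) {p q : ℝ → ℝ → ℝ}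
    (hp : Continuous (Function.uncurry p)) (hq : Continuous (Function.uncurry q))
    (hp0 : ∀ z y, 1 ≤ z ∨ 1 ≤ y → p z y = 0)
    (hder : ∀ z ∈ Ioo (0 : ℝ) 1, ∀ y ∈ Ioo (0 : ℝ) 1,
      HasDerivAt (fun a => p (z + a) (y + a)) (r * p z 0 * p 0 y - q z y) 0)
    (hpn : KernelNonneg p) (hqn : KernelNonneg q) {h : ℝ → ℝ}
    (hint : ∀ N, 0 ≤ N → IntervalIntegrable h volume (-1) N)
    (heq : ∀ s, 0 ≤ s → h s = -(r * ∫ y in (0 : ℝ)..1, p 0 y * h (s - y))) :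
    Tendsto h atTop (𝓝 0) := by
  have hk : Continuous fun y => p 0 y := hp.comp (by fun_prop : Continuous fun y : ℝ => ((0 : ℝ), y))
  have hc := continuousOn_of_delay_equation hk (fun y hy => hp0 0 y (Or.inr hy)) hint heq
  set H : ℝ → ℝ := fun s => h (max 0 s) with hH
  have hHc : Continuous H := hc.comp_continuous (by fun_prop) fun s => mem_Ici.2 (le_max_left _ _)
  have hHeq : ∀ t, 1 ≤ t → H t = -(r * ∫ y in (0 : ℝ)..1, p 0 y * H (t - y)) := by
    intro t ht
    rw [hH]
    dsimp only
    rw [max_eq_right (zero_le_one.trans ht), heq t (zero_le_one.trans ht)]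
    congr 2
    refine intervalIntegral.integral_congr fun y hy => ?_
    rw [uIcc_of_le zero_le_one] at hy
    rw [max_eq_right (by linarith [hy.2])]
  obtain ⟨C, hC⟩ := exists_bound_integral_sq hr hp hq hp0 hder hpn hqn hHc hHeq
  refine (tendsto_zero_of_bound_integral_sq hk hHc hHeq hC).congr' ?_
  filter_upwards [eventually_ge_atTop 0] with t ht
  rw [hH]
  dsimp only
  rw [max_eq_right ht]

/-! ### Kernels extended from the unit square to the plane -/

/-- Extension of a kernel from the unit square to the plane, constant beyond the edges. -/
def clampedKernel (K : ℝ → ℝ → ℝ) (z y : ℝ) : ℝ := K (max 0 (min 1 z)) (max 0 (min 1 y))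

lemma clampedKernel_of_mem (K : ℝ → ℝ → ℝ) {z y : ℝ} (hz : z ∈ Icc (0 : ℝ) 1)
    (hy : y ∈ Icc (0 : ℝ) 1) : clampedKernel K z y = K z y := by
  rw [clampedKernel, min_eq_right hz.2, min_eq_right hy.2, max_eq_right hz.1, max_eq_right hy.1]

lemma max_zero_min_one_mem (x : ℝ) : max 0 (min 1 x) ∈ Icc (0 : ℝ) 1 :=
  ⟨le_max_left _ _, max_le zero_le_one (min_le_left _ _)⟩

lemma continuous_clampedKernel {K : ℝ → ℝ → ℝ}
    (hK : ContinuousOn (Function.uncurry K) (Icc 0 1 ×ˢ Icc 0 1)) :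
    Continuous (Function.uncurry (clampedKernel K)) :=
  hK.comp_continuous
    (by fun_prop : Continuous fun x : ℝ × ℝ => (max 0 (min 1 x.1), max 0 (min 1 x.2)))
    fun x => ⟨max_zero_min_one_mem x.1, max_zero_min_one_mem x.2⟩

lemma KernelNonneg.congr {K K' : ℝ → ℝ → ℝ} (hK : KernelNonneg K)
    (h : ∀ z ∈ Icc (0 : ℝ) 1, ∀ y ∈ Icc (0 : ℝ) 1, K' z y = K z y) : KernelNonneg K' := by
  intro f hf
  refine (hK f hf).trans_eq (intervalIntegral.integral_congr fun z hz => ?_)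
  rw [uIcc_of_le zero_le_one] at hz
  refine congrArg (f z * ·) (intervalIntegral.integral_congr fun y hy => ?_)
  rw [uIcc_of_le zero_le_one] at hy
  rw [h z hz y hy]

lemma KernelNonneg.const_mul {K : ℝ → ℝ → ℝ} (hK : KernelNonneg K) {c : ℝ} (hc : 0 ≤ c) :
    KernelNonneg fun z y => c * K z y := by
  intro f hf
  refine (mul_nonneg hc (hK f hf)).trans_eq ?_
  rw [← intervalIntegral.integral_const_mul]
  refine intervalIntegral.integral_congr fun z _ => ?_
  dsimp only
  rw [mul_left_comm, ← intervalIntegral.integral_const_mul]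
  exact congrArg (f z * ·) (intervalIntegral.integral_congr fun y _ => (mul_assoc _ _ _).symm)

/-- The Riccati equation for the clamped kernel, with the transport speed scaled to one. -/
lemma IsSteadyStateKernel.hasDerivAt_clampedKernel {v R : ℝ} {q₁ P : ℝ → ℝ → ℝ} (hv : 0 < v)
    (hP : IsSteadyStateKernel v R q₁ P) {z y : ℝ} (hz : z ∈ Ioo (0 : ℝ) 1)
    (hy : y ∈ Ioo (0 : ℝ) 1) :
    HasDerivAt (fun a => clampedKernel P (z + a) (y + a))
      ((R * v)⁻¹ * clampedKernel P z 0 * clampedKernel P 0 y - v⁻¹ * clampedKernel q₁ z y) 0 := by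
  have h0 : (0 : ℝ) ∈ Icc (0 : ℝ) 1 := ⟨le_rfl, zero_le_one⟩
  have hz' := Ioo_subset_Icc_self hz
  have hy' := Ioo_subset_Icc_self hy
  rw [clampedKernel_of_mem P hz' h0, clampedKernel_of_mem P h0 hy', clampedKernel_of_mem q₁ hz' hy']
  have hline := (hP.riccati z hz' y hy').hasLineDerivAt'
    (by
      have hmem : Ioo (0 : ℝ) 1 ×ˢ Ioo (0 : ℝ) 1 ∈ 𝓝 (z, y) :=
        prod_mem_nhds (Ioo_mem_nhds hz.1 hz.2) (Ioo_mem_nhds hy.1 hy.2)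
      have hc : ContinuousAt (fun t : ℝ => (z, y) + t • (v, v)) 0 := by fun_prop
      have h1 : Ioo (0 : ℝ) 1 ×ˢ Ioo (0 : ℝ) 1 ∈ 𝓝 ((z, y) + (0 : ℝ) • (v, v)) := by simpa using hmem
      filter_upwards [hc h1] with t ht
      exact prod_mono Ioo_subset_Icc_self Ioo_subset_Icc_self ht)
  have h2 : HasDerivAt (fun t : ℝ => Function.uncurry P ((z, y) + t • (v, v)))
      (R⁻¹ * P z 0 * P 0 y - q₁ z y) (v⁻¹ * 0) := by
    rw [mul_zero]; exact hline
  have h3 := h2.scomp (h := fun a : ℝ => v⁻¹ * a) 0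
    ((hasDerivAt_id (0 : ℝ)).const_mul v⁻¹)
  refine HasDerivAt.congr_of_eventuallyEq
    (f := fun a : ℝ => Function.uncurry P ((z, y) + (v⁻¹ * a) • (v, v))) ?_ ?_
  · refine h3.congr_deriv ?_
    rw [smul_eq_mul, mul_inv]; ring
  · have e1 : ∀ᶠ a in 𝓝 (0 : ℝ), z + a ∈ Ioo (0 : ℝ) 1 :=
      ContinuousAt.eventually_mem (by fun_prop) (by simpa using Ioo_mem_nhds hz.1 hz.2)
    have e2 : ∀ᶠ a in 𝓝 (0 : ℝ), y + a ∈ Ioo (0 : ℝ) 1 :=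
      ContinuousAt.eventually_mem (by fun_prop) (by simpa using Ioo_mem_nhds hy.1 hy.2)
    filter_upwards [e1, e2] with a ha1 ha2
    rw [clampedKernel_of_mem P (Ioo_subset_Icc_self ha1) (Ioo_subset_Icc_self ha2)]
    have : v⁻¹ * a * v = a := by field_simp
    simp [this]

/-! ### The inflow history of a production line -/

/-- A solution of the production line is constant along characteristics. -/
lemma IsProductionLine.eq_along_characteristic {v : ℝ} {ρ₀ u : ℝ → ℂ} {ρ : ℝ → ℝ → ℂ} (hv : 0 < v)
    (hρ : IsProductionLine v ρ₀ u ρ) {z t a : ℝ} (hz : 0 ≤ z) (ht : 0 ≤ t) (ha : 0 ≤ a)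
    (hza : z + a * v ≤ 1) : ρ (z + a * v) (t + a) = ρ z t := by
  set f : ℝ → ℂ := fun x => ρ (z + x * v) (t + x) with hf
  have hmaps : ∀ x ∈ Icc 0 a, (z + x * v, t + x) ∈ Icc (0 : ℝ) 1 ×ˢ Ici (0 : ℝ) := fun x hx => by
    have h1 : 0 ≤ x * v := mul_nonneg hx.1 hv.le
    have h2 : x * v ≤ a * v := mul_le_mul_of_nonneg_right hx.2 hv.le
    exact ⟨⟨by dsimp only; linarith, by dsimp only; linarith⟩, add_nonneg ht hx.1⟩
  have hder : ∀ x ∈ Icc 0 a, HasDerivWithinAt f 0 (Icc 0 a) x := by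
    intro x hx
    have h1 := hρ.transport (z + x * v) (hmaps x hx).1 (t + x) (hmaps x hx).2
    have h2 : HasDerivWithinAt (fun b : ℝ => Function.uncurry ρ ((z + x * v, t + x) + b • (v, (1 : ℝ)))) 0
        ((fun b : ℝ => (z + x * v, t + x) + b • (v, (1 : ℝ))) ⁻¹' (Icc 0 1 ×ˢ Ici 0)) (x - x) := by
      rw [sub_self]; exact h1
    have h3 := h2.scomp (h := fun b : ℝ => b - x) x (((hasDerivAt_id x).sub_const x).hasDerivWithinAt (s := Icc 0 a)) (by
      intro b hb
      have := hmaps b hb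
      have e : (z + x * v, t + x) + (b - x) • (v, (1 : ℝ)) = (z + b * v, t + b) := by
        ext <;> simp; ring
      simpa only [mem_preimage, id, e] using this)
    rw [smul_zero] at h3
    refine h3.congr_of_eventuallyEq (Eventually.of_forall fun b => ?_) ?_
    · have e : (z + x * v, t + x) + (b - x) • (v, (1 : ℝ)) = (z + b * v, t + b) := by
        ext <;> simp; ring
      simp only [Function.comp, e, hf, Function.uncurry]
    · simp [hf]
  have hconst := constant_of_derivWithin_zero (f := f) (a := 0) (b := a)
    (fun x hx => (hder x hx).differentiableWithinAt)
    (fun x hx => (hder x (Ico_subset_Icc_self hx)).derivWithin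
      (uniqueDiffOn_Icc (hx.1.trans_lt hx.2) x (Ico_subset_Icc_self hx))) a ⟨ha, le_rfl⟩
  simpa [hf] using hconst

/-- The history of the inflow of a production line in position units: the boundary density at the
time `s / v` for `s ≥ 0`, continued by the initial profile read backwards for `s < 0`. -/
noncomputable def inflowHistory (v : ℝ) (ρ : ℝ → ℝ → ℂ) (s : ℝ) : ℂ :=
  if 0 ≤ s then ρ 0 (s / v) else ρ (-s) 0

/-- Every density value is a value of the inflow history, found by following the characteristic
through `(z,t)` back to the inflow boundary or to the initial line. -/
lemma IsProductionLine.eq_inflowHistory {v : ℝ} {ρ₀ u : ℝ → ℂ} {ρ : ℝ → ℝ → ℂ} (hv : 0 < v)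
    (hρ : IsProductionLine v ρ₀ u ρ) {z t : ℝ} (hz : z ∈ Icc (0 : ℝ) 1) (ht : 0 ≤ t) :
    ρ z t = inflowHistory v ρ (v * t - z) := by
  unfold inflowHistory
  split_ifs with h
  · have h1 : z / v * v = z := by field_simp
    have h2 : (v * t - z) / v + z / v = t := by field_simp; ring
    have := hρ.eq_along_characteristic hv le_rfl (div_nonneg h hv.le) (div_nonneg hz.1 hv.le)
      (by rw [h1, zero_add]; exact hz.2)
    rw [h1, h2, zero_add] at this
    exact this
  · have h1 : -(v * t - z) + t * v = z := by ring
    have := hρ.eq_along_characteristic hv (z := -(v * t - z)) (by linarith) le_rfl ht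
      (by rw [h1]; exact hz.2)
    rwa [h1, zero_add] at this

lemma IsProductionLine.intervalIntegrable_inflowHistory {v : ℝ} {ρ₀ u : ℝ → ℂ} {ρ : ℝ → ℝ → ℂ}
    (hv : 0 < v) (hρ : IsProductionLine v ρ₀ u ρ) {N : ℝ} (hN : 0 ≤ N) :
    IntervalIntegrable (inflowHistory v ρ) volume (-1) N := by
  have hstep : ∀ k : ℕ, IntervalIntegrable (inflowHistory v ρ) volume ((k : ℝ) - 1)
      ((k + 1 : ℕ) - 1 : ℝ) := by
    intro k
    have ht : 0 ≤ (k : ℝ) / v := by positivity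
    have h1 := (hρ.integrable _ ht).comp_sub_left (k : ℝ)
    rw [sub_zero] at h1
    have h2 : IntervalIntegrable (inflowHistory v ρ) volume (k : ℝ) (k - 1) := by
      refine h1.congr fun s hs => ?_
      rw [uIoc_of_ge (by linarith)] at hs
      rw [hρ.eq_inflowHistory hv ⟨by linarith [hs.2], by linarith [hs.1]⟩ ht]
      congr 1
      field_simp
      ring
    have e : ((k + 1 : ℕ) - 1 : ℝ) = k := by push_cast; ring
    rw [e]
    exact h2.symm
  obtain ⟨n, hn⟩ := exists_nat_ge (N + 1)
  have := IntervalIntegrable.trans_iterate (f := inflowHistory v ρ) (μ := volume)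
    (a := fun k : ℕ => (k : ℝ) - 1) (n := n) fun k _ => hstep k
  simp only [Nat.cast_zero, zero_sub] at this
  refine this.mono_set ?_
  rw [uIcc_of_le (by linarith), uIcc_of_le (by linarith)]
  exact Icc_subset_Icc_right (by linarith)

/-- Under the optimal feedback the inflow history solves a delay equation. -/
lemma IsProductionLine.inflowHistory_delay_equation {v R : ℝ} (hv : 0 < v) {P : ℝ → ℝ → ℝ}
    {ρ₀ : ℝ → ℂ} {ρ : ℝ → ℝ → ℂ} (hρ : IsProductionLine v ρ₀ (optimalFeedback R P ρ) ρ)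
    {s : ℝ} (hs : 0 ≤ s) :
    inflowHistory v ρ s
      = -(((R * v)⁻¹ : ℝ) * ∫ y in (0 : ℝ)..1, (P 0 y : ℂ) * inflowHistory v ρ (s - y)) := by
  have ht : 0 ≤ s / v := div_nonneg hs hv.le
  have hvt : v * (s / v) = s := by field_simp
  have h1 := hρ.influx (s / v) ht
  have h2 : ρ 0 (s / v) = inflowHistory v ρ s := by
    have := hρ.eq_inflowHistory hv ⟨le_rfl, zero_le_one⟩ ht
    rwa [hvt, sub_zero] at this
  have h3 : ∫ y in (0 : ℝ)..1, (P 0 y : ℂ) * ρ y (s / v)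
      = ∫ y in (0 : ℝ)..1, (P 0 y : ℂ) * inflowHistory v ρ (s - y) := by
    refine intervalIntegral.integral_congr fun y hy => ?_
    rw [uIcc_of_le zero_le_one] at hy
    rw [hρ.eq_inflowHistory hv hy ht, hvt]
  rw [optimalFeedback, h2, h3] at h1
  have hv' : (v : ℂ) ≠ 0 := by exact_mod_cast hv.ne'
  apply mul_left_cancel₀ hv'
  rw [h1]
  push_cast
  rw [mul_inv]
  field_simp

/-- The closed loop under the optimal feedback is stable: its outgoing density tends to zero. -/
lemma IsProductionLine.tendsto_outgoing_zero {v R : ℝ} (hv : 0 < v) (hR : 0 < R)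
    {q₁ P : ℝ → ℝ → ℝ} (hq₁ : ContinuousOn (Function.uncurry q₁) (Icc 0 1 ×ˢ Icc 0 1))
    (hq₁_nonneg : KernelNonneg q₁) (hP : IsSteadyStateKernel v R q₁ P)
    {ρ₀ : ℝ → ℂ} {ρ : ℝ → ℝ → ℂ} (hρ : IsProductionLine v ρ₀ (optimalFeedback R P ρ) ρ) :
    Tendsto (fun t => ρ 1 t) atTop (𝓝 0) := by
  set g := inflowHistory v ρ with hg
  have hgi : ∀ N, 0 ≤ N → IntervalIntegrable g volume (-1) N := fun N hN =>
    hρ.intervalIntegrable_inflowHistory hv hN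
  have hp := continuous_clampedKernel hP.continuousOn
  -- the feedback gain is real, so real and imaginary parts solve the same delay equation
  have hpart : ∀ L : ℂ →L[ℝ] ℝ, Tendsto (fun s => L (g s)) atTop (𝓝 0) := by
    intro L
    refine tendsto_zero_of_delay_equation (r := (R * v)⁻¹) (p := clampedKernel P)
      (q := fun z y => v⁻¹ * clampedKernel q₁ z y) (by positivity) hp
      (continuous_const.mul (continuous_clampedKernel hq₁)) ?_
      (fun z hz y hy => hP.hasDerivAt_clampedKernel hv hz hy)
      (hP.nonneg.congr fun z hz y hy => clampedKernel_of_mem P hz hy)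
      ((hq₁_nonneg.congr fun z hz y hy => clampedKernel_of_mem q₁ hz hy).const_mul
        (inv_nonneg.2 hv.le)) ?_ ?_
    · rintro z y (h | h)
      · rw [clampedKernel, min_eq_left h, max_eq_right zero_le_one]
        exact hP.left_zero _ (max_zero_min_one_mem y)
      · rw [clampedKernel, min_eq_left h, max_eq_right zero_le_one]
        exact hP.right_zero _ (max_zero_min_one_mem z)
    · intro N hN
      exact ⟨L.integrable_comp (hgi N hN).1, L.integrable_comp (hgi N hN).2⟩
    · intro s hs
      have hi : IntervalIntegrable (fun y => (clampedKernel P 0 y : ℂ) * g (s - y)) volume 0 1 := by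
        have h1 : IntervalIntegrable g volume s (s - 1) := (hgi s hs).symm.mono_set (by
          rw [uIcc_of_ge (by linarith), uIcc_of_ge (by linarith)]
          exact Icc_subset_Icc_left (by linarith))
        have h2 := h1.comp_sub_left s
        simp only [sub_self, sub_sub_cancel] at h2
        have hc : Continuous fun y : ℝ => (clampedKernel P 0 y : ℂ) :=
          Complex.continuous_ofReal.comp
            (hp.comp (by fun_prop : Continuous fun y : ℝ => ((0 : ℝ), y)))
        exact h2.continuousOn_mul hc.continuousOn
      have h3 : ∫ y in (0 : ℝ)..1, (P 0 y : ℂ) * g (s - y)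
          = ∫ y in (0 : ℝ)..1, (clampedKernel P 0 y : ℂ) * g (s - y) := by
        refine intervalIntegral.integral_congr fun y hy => ?_
        rw [uIcc_of_le zero_le_one] at hy
        rw [clampedKernel_of_mem P ⟨le_rfl, zero_le_one⟩ hy]
      have hreal : ∀ (c : ℝ) (x : ℂ), L ((c : ℂ) * x) = c * L x := fun c x => by
        rw [← Complex.real_smul, L.map_smul, smul_eq_mul]
      rw [hg, hρ.inflowHistory_delay_equation hv hs, ← hg, h3, map_neg, hreal,
        ← L.intervalIntegral_comp_comm hi]
      simp_rw [hreal]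
  have hg0 : Tendsto g atTop (𝓝 0) := by
    have h1 : Tendsto (fun s => ((g s).re : ℂ) + (g s).im * Complex.I) atTop
        (𝓝 (((0 : ℝ) : ℂ) + ((0 : ℝ) : ℂ) * Complex.I)) :=
      ((Complex.continuous_ofReal.tendsto 0).comp (hpart Complex.reCLM)).add
        (((Complex.continuous_ofReal.tendsto 0).comp (hpart Complex.imCLM)).mul_const _)
    simpa [Complex.re_add_im] using h1
  have harg : Tendsto (fun t : ℝ => v * t - 1) atTop atTop :=
    tendsto_atTop_add_const_right _ _ (tendsto_id.const_mul_atTop hv)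
  refine (hg0.comp harg).congr' ?_
  filter_upwards [eventually_ge_atTop 0] with t ht
  exact (hρ.eq_inflowHistory hv ⟨zero_le_one, le_rfl⟩ ht).symm

/-! ### The regulator equations -/

lemma IsRegulatorSolution.hasDerivWithinAt {n : ℕ} {v : ℝ} (hv : 0 < v)
    {S : Matrix (Fin n) (Fin n) ℂ} {qr : Fin n → ℂ} {m : ℝ → Fin n → ℂ}
    (hm : IsRegulatorSolution v S qr m) {z : ℝ} (hz : z ∈ Icc (0 : ℝ) 1) :
    HasDerivWithinAt m (-((v : ℂ)⁻¹ • (m z ᵥ* S))) (Icc 0 1) z := by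
  have hv' : (v : ℂ) ≠ 0 := by exact_mod_cast hv.ne'
  refine (hm.differentiable z hz).hasDerivWithinAt.congr_deriv ?_
  rw [eq_neg_of_add_eq_zero_right (hm.ode z hz), smul_neg, neg_neg, inv_smul_smul₀ hv']

/-- The solution is `z ↦ v⁻¹ q_rᵀ exp((1 - z) S / v)`. -/
lemma exists_isRegulatorSolution {n : ℕ} {v : ℝ} (hv : 0 < v) (S : Matrix (Fin n) (Fin n) ℂ)
    (qr : Fin n → ℂ) : ∃ m, IsRegulatorSolution v S qr m := by
  have hv' : (v : ℂ) ≠ 0 := by exact_mod_cast hv.ne'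
  set A : (Fin n → ℂ) →L[ℂ] (Fin n → ℂ) :=
    LinearMap.toContinuousLinearMap (Matrix.vecMulLinear S) with hA
  set m : ℝ → Fin n → ℂ := fun z =>
    NormedSpace.exp (((1 - z) / v : ℝ) • A) ((v : ℂ)⁻¹ • qr) with hm
  have hder : ∀ z, HasDerivAt m (-((v : ℂ)⁻¹ • (m z ᵥ* S))) z := by
    intro z
    have h1 : HasDerivAt (fun z : ℝ => (1 - z) / v) (-1 / v) z :=
      ((hasDerivAt_id z).const_sub 1).div_const v
    have h2 := (hasDerivAt_exp_smul_const' (𝕂 := ℝ) A ((1 - z) / v)).scomp z h1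
    have h3 := ((ContinuousLinearMap.apply ℂ (Fin n → ℂ) ((v : ℂ)⁻¹ • qr)).restrictScalars
      ℝ).hasFDerivAt.comp_hasDerivAt z h2
    refine h3.congr_deriv ?_
    rw [map_smul]
    change (-1 / v) • (m z ᵥ* S) = _
    rw [← Complex.coe_smul, ← neg_smul]
    congr 1
    push_cast
    ring
  refine ⟨m, fun z _ => (hder z).differentiableAt.differentiableWithinAt, fun z hz => ?_, ?_⟩
  · rw [(hder z).hasDerivWithinAt.derivWithin (uniqueDiffOn_Icc zero_lt_one z hz), smul_neg,
      smul_inv_smul₀ hv', neg_add_cancel]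
  · have h0 : ((1 - 1) / v : ℝ) • A = 0 := by rw [sub_self, zero_div]; exact zero_smul ℝ A
    change NormedSpace.exp (((1 - 1) / v : ℝ) • A) ((v : ℂ)⁻¹ • qr) = _
    rw [h0, NormedSpace.exp_zero, one_apply_eq_self]

lemma IsRegulatorSolution.eqOn {n : ℕ} {v : ℝ} (hv : 0 < v) {S : Matrix (Fin n) (Fin n) ℂ}
    {qr : Fin n → ℂ} {m m' : ℝ → Fin n → ℂ} (hm : IsRegulatorSolution v S qr m)
    (hm' : IsRegulatorSolution v S qr m') : EqOn m m' (Icc 0 1) := by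
  set A : (Fin n → ℂ) →L[ℂ] (Fin n → ℂ) :=
    -((v : ℂ)⁻¹ • LinearMap.toContinuousLinearMap (Matrix.vecMulLinear S)) with hA
  have hder : ∀ {m : ℝ → Fin n → ℂ}, IsRegulatorSolution v S qr m →
      ∀ z ∈ Ioc (0 : ℝ) 1, HasDerivWithinAt m (A (m z)) (Iic z) z := fun hm z hz =>
    (hm.hasDerivWithinAt hv (Ioc_subset_Icc_self hz)).mono_of_mem_nhdsWithin
      (mem_of_superset (Icc_mem_nhdsLE hz.1) (Icc_subset_Icc_right hz.2))
  exact ODE_solution_unique_of_mem_Icc_left (v := fun _ => A) (s := fun _ => univ)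
    (fun _ _ => A.lipschitz.lipschitzOnWith) hm.differentiable.continuousOn (hder hm)
    (fun _ _ => mem_univ _) hm'.differentiable.continuousOn (hder hm') (fun _ _ => mem_univ _)
    (hm.terminal.trans hm'.terminal.symm)

/-! ### The error state -/

/-- The stationary response `m(z) w(t)` is itself transported, because `m` solves the regulator
equations. -/
lemma IsRegulatorSolution.hasLineDerivWithinAt_response {n : ℕ} {v : ℝ} (hv : 0 < v)
    {S : Matrix (Fin n) (Fin n) ℂ} {qr : Fin n → ℂ} {m w : ℝ → Fin n → ℂ}
    (hm : IsRegulatorSolution v S qr m) (hw : IsExosystem S w) {z t : ℝ}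
    (hz : z ∈ Icc (0 : ℝ) 1) (ht : 0 ≤ t) :
    HasLineDerivWithinAt ℝ (Function.uncurry fun z t => m z ⬝ᵥ w t) 0 (Icc 0 1 ×ˢ Ici 0)
      (z, t) (v, 1) := by
  have hv' : (v : ℂ) ≠ 0 := by exact_mod_cast hv.ne'
  unfold HasLineDerivWithinAt
  set s : Set ℝ := (fun a : ℝ => (z, t) + a • (v, (1 : ℝ))) ⁻¹' (Icc 0 1 ×ˢ Ici 0)
  have h1 : HasDerivWithinAt (fun a : ℝ => m (z + a * v))
      (v • -((v : ℂ)⁻¹ • (m z ᵥ* S))) s 0 := by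
    refine HasDerivWithinAt.scomp (h := fun a : ℝ => z + a * v) (t' := Icc 0 1) 0 ?_ ?_ ?_
    · have := hm.hasDerivWithinAt hv hz
      rwa [zero_mul, add_zero]
    · simpa using (((hasDerivAt_id (0 : ℝ)).mul_const v).const_add z).hasDerivWithinAt (s := s)
    · intro a ha
      have := ha.1
      simpa using this
  have h2 : HasDerivWithinAt (fun a : ℝ => w (t + a)) (S *ᵥ w t) s 0 := by
    rw [← one_smul ℝ (S *ᵥ w t)]
    refine HasDerivWithinAt.scomp (h := fun a : ℝ => t + a) (t' := Ici 0) 0 ?_ ?_ ?_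
    · have := hw t ht
      rwa [add_zero]
    · exact ((hasDerivAt_id (0 : ℝ)).const_add t).hasDerivWithinAt
    · intro a ha
      have := ha.2
      simpa using this
  have h3 := HasDerivWithinAt.fun_sum (u := Finset.univ) fun i _ =>
    (hasDerivWithinAt_pi.1 h1 i).mul (hasDerivWithinAt_pi.1 h2 i)
  have hval : v • -((v : ℂ)⁻¹ • (m z ᵥ* S)) = -(m z ᵥ* S) := by
    rw [← Complex.coe_smul, smul_neg, smul_inv_smul₀ hv']
  rw [hval] at h3
  have hzero : (0 : ℂ) = -(m z ᵥ* S) ⬝ᵥ w t + m z ⬝ᵥ S *ᵥ w t := by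
    rw [Matrix.dotProduct_mulVec, neg_dotProduct, neg_add_cancel]
  rw [hzero]
  convert h3 using 1
  · ext a
    simp [dotProduct]
  · simp [dotProduct, Finset.sum_add_distrib]

/-- The influx condition of the error state: the feedforward gain is exactly what the optimal
feedback withholds from the stationary response `m(z) w(t)`. -/
lemma trackingControl_sub_response {n : ℕ} {v R : ℝ} (hv : 0 < v) {P : ℝ → ℝ → ℝ}
    (hP : ContinuousOn (fun y => P 0 y) (Icc 0 1)) {m w : ℝ → Fin n → ℂ}
    (hm : ContinuousOn m (Icc 0 1)) {ρ : ℝ → ℝ → ℂ} {t : ℝ}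
    (hρ : IntervalIntegrable (fun z => ρ z t) volume 0 1) :
    trackingControl v R P (feedforwardGain v R P m) w ρ t - v * (m 0 ⬝ᵥ w t)
      = optimalFeedback R P (errorState m w ρ) t := by
  have hv' : (v : ℂ) ≠ 0 := by exact_mod_cast hv.ne'
  have hPc : ContinuousOn (fun y => (P 0 y : ℂ)) (uIcc 0 1) := by
    rw [uIcc_of_le zero_le_one]; exact Complex.continuous_ofReal.comp_continuousOn hP
  have hPm : IntervalIntegrable (fun y => (P 0 y : ℂ) • m y) volume 0 1 :=
    (hPc.smul (by rwa [uIcc_of_le zero_le_one])).intervalIntegrable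
  let φ : (Fin n → ℂ) →L[ℂ] ℂ := ∑ i, w t i • ContinuousLinearMap.proj i
  have hφ : ∀ x, φ x = x ⬝ᵥ w t := fun x => by
    simp [φ, dotProduct, mul_comm]
  have h1 : (∫ y in (0 : ℝ)..1, (P 0 y : ℂ) • m y) ⬝ᵥ w t
      = ∫ y in (0 : ℝ)..1, (P 0 y : ℂ) * (m y ⬝ᵥ w t) := by
    rw [← hφ, ← φ.intervalIntegral_comp_comm hPm]
    refine intervalIntegral.integral_congr fun y _ => ?_
    simp [hφ]
  have hPmw : IntervalIntegrable (fun y => (P 0 y : ℂ) * (m y ⬝ᵥ w t)) volume 0 1 := by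
    refine ((hPc.mul ?_)).intervalIntegrable
    rw [uIcc_of_le zero_le_one]
    exact (φ.continuous.comp_continuousOn hm).congr fun y _ => (hφ _).symm
  have h2 : ∫ y in (0 : ℝ)..1, (P 0 y : ℂ) * errorState m w ρ y t
      = (∫ y in (0 : ℝ)..1, (P 0 y : ℂ) * ρ y t)
        - ∫ y in (0 : ℝ)..1, (P 0 y : ℂ) * (m y ⬝ᵥ w t) := by
    rw [← intervalIntegral.integral_sub (hρ.continuousOn_mul hPc) hPmw]
    exact intervalIntegral.integral_congr fun y _ => mul_sub _ _ _
  rw [trackingControl, feedforwardGain, optimalFeedback, optimalFeedback, h2, add_dotProduct,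
    smul_dotProduct, h1, mul_inv, smul_eq_mul]
  field_simp
  ring

/-- The error state is a production line closed by the optimal feedback alone. -/
lemma IsProductionLine.errorState {n : ℕ} {v R : ℝ} (hv : 0 < v) {q₁ P : ℝ → ℝ → ℝ}
    (hP : IsSteadyStateKernel v R q₁ P) {S : Matrix (Fin n) (Fin n) ℂ} {qr : Fin n → ℂ}
    {m w : ℝ → Fin n → ℂ} (hm : IsRegulatorSolution v S qr m) (hw : IsExosystem S w)
    {ρ₀ : ℝ → ℂ} {ρ : ℝ → ℝ → ℂ}
    (hρ : IsProductionLine v ρ₀ (trackingControl v R P (feedforwardGain v R P m) w ρ) ρ) :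
    IsProductionLine v (fun z => ρ₀ z - m z ⬝ᵥ w 0)
      (optimalFeedback R P (errorState m w ρ)) (errorState m w ρ) where
  integrable t ht := by
    refine (hρ.integrable t ht).sub (ContinuousOn.intervalIntegrable ?_)
    rw [uIcc_of_le zero_le_one]
    have := hm.differentiable.continuousOn
    simp only [dotProduct]
    fun_prop
  transport z hz t ht := by
    have h := HasDerivWithinAt.sub (hρ.transport z hz t ht)
      (hm.hasLineDerivWithinAt_response hv hw hz ht)
    rw [sub_zero] at h
    exact h
  influx t ht := by
    have hP0 : ContinuousOn (fun y => P 0 y) (Icc 0 1) :=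
      hP.continuousOn.comp (f := fun y : ℝ => ((0 : ℝ), y)) (by fun_prop)
        fun y hy => ⟨⟨le_rfl, zero_le_one⟩, hy⟩
    rw [← trackingControl_sub_response hv hP0 hm.differentiable.continuousOn
      (hρ.integrable t ht), ← hρ.influx t ht, _root_.errorState, mul_sub]
  initial z hz := by
    rw [_root_.errorState, hρ.initial z hz]

theorem theorem3 {n : ℕ} (v R : ℝ) (hv : 0 < v) (hR : 0 < R)
    (q₁ P : ℝ → ℝ → ℝ)
    (hq₁ : ContinuousOn (Function.uncurry q₁) (Icc 0 1 ×ˢ Icc 0 1))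
    (hq₁_nonneg : KernelNonneg q₁)
    (hP : IsSteadyStateKernel v R q₁ P)
    (S : Matrix (Fin n) (Fin n) ℂ) (qr : Fin n → ℂ) :
    -- the regulator equations have exactly one solution on `[0,1]`
    (∃ m, IsRegulatorSolution v S qr m) ∧
    (∀ m m', IsRegulatorSolution v S qr m → IsRegulatorSolution v S qr m' →
      EqOn m m' (Icc 0 1)) ∧
    -- and the feedforward gain built from it achieves tracking of the demand `q_r w(t)`
    ∀ m, IsRegulatorSolution v S qr m →
      ∀ w, IsExosystem S w →
        ∀ (ρ₀ : ℝ → ℂ) (ρ : ℝ → ℝ → ℂ),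
          IsProductionLine v ρ₀ (trackingControl v R P (feedforwardGain v R P m) w ρ) ρ →
            IsProductionLine v (fun z => ρ₀ z - m z ⬝ᵥ w 0)
              (optimalFeedback R P (errorState m w ρ)) (errorState m w ρ) ∧
            (∀ t : ℝ, 0 ≤ t → outflux v ρ t - qr ⬝ᵥ w t = (v : ℂ) * errorState m w ρ 1 t) ∧
            Tendsto (fun t => outflux v ρ t - qr ⬝ᵥ w t) atTop (𝓝 0) := by

  refine ⟨exists_isRegulatorSolution hv S qr, fun m m' hm hm' => hm.eqOn hv hm',
    fun m hm w hw ρ₀ ρ hρ => ?_⟩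
  have he := IsProductionLine.errorState hv hP hm hw hρ
  have hy : ∀ t, outflux v ρ t - qr ⬝ᵥ w t = (v : ℂ) * errorState m w ρ 1 t := by
    intro t
    have hv' : (v : ℂ) ≠ 0 := by exact_mod_cast hv.ne'
    rw [outflux, errorState, hm.terminal, smul_dotProduct, mul_sub, smul_eq_mul,
      mul_inv_cancel_left₀ hv']
  refine ⟨he, fun t _ => hy t, ?_⟩
  simp only [hy]
  simpa using (he.tendsto_outgoing_zero hv hR hq₁ hq₁_nonneg hP).const_mul (v : ℂ)
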